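/- Let $\Omega\subset\mathbb{R}^d$ be a non-empty convex open set, $c:\Omega^2\to[0,\infty)$ a lower semicontinuous function, $\lambda_1,\lambda_2:\Omega\to[0,\infty)$ bounded measurable functions, and $\epsilon>0$. Let $dx,dy$ be Borel probability measures on $\Omega$, write $dxdy=dx\otimes dy$, and let $\mu,\nu$ be finite positive Borel measures on $\Omega$ with $\mu\ll dx$ and $\nu\ll dy$. Put $K=e^{-c/\epsilon}$ and write $\langle f,\alpha\rangle=\int f\,d\alpha$. For finite positive measures $\alpha,\beta$ on $\Omega$ let $TV(\alpha\|\beta)=|\alpha-\beta|(\Omega)$ be the total variation; let $\iota_\le(\alpha\|\beta)=0$ if $\alpha\le\beta$ and $+\infty$ otherwise; let $PTV(\alpha\|\beta)=TV(\alpha\|\beta)+\iota_\le(\alpha\|\beta)$; and for bounded measurable $\lambda\ge0$ let $\overline{PTV}(\lambda\alpha\|\lambda\beta)=PTV(\lambda\alpha\|\lambda\beta)+\iota_\le(\alpha\|\beta)$. Choose $D_1,D_2\in\{TV,\overline{PTV}\}$ independently of each other (all four combinations are allowed), and set $$EGOPT=\inf_{\gamma}\ \langle c,\gamma\rangle-\epsilon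 H(\gamma)+D_1(\lambda_1\gamma_1\|\lambda_1\mu)+D_2(\lambda_2\gamma_2\|\lambda_2\nu),$$ where the infimum is over the finite positive Borel measures $\gamma$ on $\Omega^2$ with $\gamma\ll dxdy$, $\gamma_1,\gamma_2$ are the marginals of $\gamma$, and $$-H(\gamma)=\int_{\Omega^2}\Bigl(\ln\frac{d\gamma}{dxdy}-1\Bigr)\frac{d\gamma}{dxdy}\,dxdy\in(-\infty,\infty],\qquad 0\ln 0=0.$$ For a bounded measurable $\lambda\ge 0$ and a probability measure $\rho$ on $\Omega$ let $$\mathcal{S}(\lambda,\rho)=\{\phi:\ \phi\ge-\lambda\ \ \rho\text{-a.e.},\ \text{ and }\ \phi=0\ \ \rho\text{-a.e. on }\{\lambda=0\}\}.$$ Then $$EGOPT=\sup_{\phi,\psi}\Bigl\{-\epsilon\bigl\langle (e^{(\phi\oplus\psi)/\epsilon}-1)K,\,dxdy\bigr\rangle+\langle\min(\phi,\lambda_1),\mu\rangle+\langle\min(\psi,\lambda_2),\nu\rangle\Bigr\}-\epsilon\langle K,dxdy\rangle,$$ where $(\phi\oplus\psi)(x,y)=\phi(x)+\psi(y)$ and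 the supremum is over all $\phi\in L^\infty(\Omega,dx)$ and $\psi\in L^\infty(\Omega,dy)$ subject to $\phi\in\mathcal{S}(\lambda_1,dx)$ if $D_1=TV$ (no further constraint on $\phi$ if $D_1=\overline{PTV}$) and $\psi\in\mathcal{S}(\lambda_2,dy)$ if $D_2=TV$ (no further constraint on $\psi$ if $D_2=\overline{PTV}$). -/

import Mathlib

open MeasureTheory Set Filter
open scoped ENNReal NNReal

namespace EGOPT

noncomputable section

variable {X : Type*} [MeasurableSpace X]

/-- Total variation `‖α - β‖_TV = |α - β|(X)` of the difference of two finite measures: the measures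
`α - β` and `β - α` (truncated differences of measures) are the positive and the negative part of the
signed measure `α - β`, see `tvDist_eq_totalVariation`. -/
def tvDist (α β : Measure X) : ℝ≥0∞ := (α - β) univ + (β - α) univ

theorem tvDist_eq_totalVariation (α β : Measure X) [IsFiniteMeasure α] [IsFiniteMeasure β] :
    tvDist α β = (α.toSignedMeasure - β.toSignedMeasure).totalVariation univ := by
  rw [SignedMeasure.totalVariation,
    Measure.toJordanDecomposition_toSignedMeasure_sub]
  rfl

open Classical in
/-- Convex indicator `ι_≤(α ‖ β)` of the constraint `α ≤ β`. -/
def leIndicator (α β : Measure X) : ℝ≥0∞ := if α ≤ β then 0 else ∞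

/-- Partial total variation: `‖β‖ - ‖α‖ = ‖β - α‖_TV` if `α ≤ β`, and `∞` otherwise. -/
def ptvDist (α β : Measure X) : ℝ≥0∞ := tvDist α β + leIndicator α β

theorem ptvDist_of_le (α β : Measure X) [IsFiniteMeasure α] (h : α ≤ β) :
    ptvDist α β = β univ - α univ := by
  simp [ptvDist, tvDist, leIndicator, h, Measure.sub_eq_zero_of_le h,
    Measure.sub_apply MeasurableSet.univ h]

theorem ptvDist_of_not_le (α β : Measure X) (h : ¬ α ≤ β) : ptvDist α β = ∞ := by
  simp [ptvDist, leIndicator, h]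

/-- The weighted measure `l α`, with density `l` with respect to `α`. -/
def weighted (l : X → ℝ≥0) (α : Measure X) : Measure X := α.withDensity (fun x => (l x : ℝ≥0∞))

/-- The two choices of a marginal penalty. -/
inductive Penalty
  | tv
  | ptvBar

/-- The marginal penalty: `TV(l α ‖ l β)`, or
`PTV-bar(l α ‖ l β) = PTV(l α ‖ l β) + ι_≤(α ‖ β)`. -/
def Penalty.cost (k : Penalty) (l : X → ℝ≥0) (α β : Measure X) : ℝ≥0∞ :=
  match k with
  | .tv => tvDist (weighted l α) (weighted l β)
  | .ptvBar => ptvDist (weighted l α) (weighted l β) + leIndicator α β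

open Classical in
/-- Negative entropy `-H(γ) = ∫ (ln r - 1) r dm` with `r = dγ/dm`, as an element of `(-∞, ∞]`.
The integrand is bounded below by `-1`, so for finite `m` the integral is `+∞` exactly when the
integrand is not integrable. -/
def negEntropy (m γ : Measure X) : EReal :=
  if Integrable (fun z => (Real.log (γ.rnDeriv m z).toReal - 1) * (γ.rnDeriv m z).toReal) m then
    ((∫ z, (Real.log (γ.rnDeriv m z).toReal - 1) * (γ.rnDeriv m z).toReal ∂m : ℝ) : EReal)
  else ⊤

/-- Objective of the entropic generalized optimal partial transport problem at the plan `γ`: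
`⟨c, γ⟩ - ε H(γ)` plus the two marginal penalties; `ρ₁ = dx` and `ρ₂ = dy`. -/
def primalObjective (c : X × X → ℝ≥0) (ε : ℝ) (k₁ k₂ : Penalty) (l₁ l₂ : X → ℝ≥0)
    (μ ν ρ₁ ρ₂ : Measure X) (γ : Measure (X × X)) : EReal :=
  ((∫⁻ z, (c z : ℝ≥0∞) ∂γ : ℝ≥0∞) : EReal) + (ε : EReal) * negEntropy (ρ₁.prod ρ₂) γ
    + ((k₁.cost l₁ (γ.map Prod.fst) μ : ℝ≥0∞) : EReal)
    + ((k₂.cost l₂ (γ.map Prod.snd) ν : ℝ≥0∞) : EReal)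

/-- The entropic generalized optimal partial transport problem: infimum of the objective over the
finite positive measures `γ` on `X × X` with `γ ≪ dxdy`. -/
def egopt (c : X × X → ℝ≥0) (ε : ℝ) (k₁ k₂ : Penalty) (l₁ l₂ : X → ℝ≥0)
    (μ ν ρ₁ ρ₂ : Measure X) : EReal :=
  ⨅ γ ∈ {γ : Measure (X × X) | IsFiniteMeasure γ ∧ γ ≪ ρ₁.prod ρ₂},
    primalObjective c ε k₁ k₂ l₁ l₂ μ ν ρ₁ ρ₂ γ

/-- The Gibbs kernel `K = e^{-c/ε}`. -/
def gibbs (c : X × X → ℝ≥0) (ε : ℝ) (z : X × X) : ℝ := Real.exp (-(c z : ℝ) / ε)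

/-- The set `S(l, ρ)` of all `φ` with `φ ≥ -l` `ρ`-a.e. and `φ = 0` `ρ|_{l = 0}`-a.e. -/
def dualSet (l : X → ℝ≥0) (ρ : Measure X) : Set (X → ℝ) :=
  {φ | (∀ᵐ x ∂ρ, -(l x : ℝ) ≤ φ x) ∧ ∀ᵐ x ∂(ρ.restrict {x | l x = 0}), φ x = 0}

/-- The constraint on a dual potential: `φ ∈ S(l, ρ)` for `TV`, none for `PTV-bar`. -/
def Penalty.dualConstraint (k : Penalty) (l : X → ℝ≥0) (ρ : Measure X) : Set (X → ℝ) :=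
  match k with
  | .tv => dualSet l ρ
  | .ptvBar => univ

/-- `-ε ⟨(e^{(φ ⊕ ψ)/ε} - 1) K, dxdy⟩ + ⟨min(φ, l₁), μ⟩ + ⟨min(ψ, l₂), ν⟩`. -/
def dualObjective (c : X × X → ℝ≥0) (ε : ℝ) (l₁ l₂ : X → ℝ≥0)
    (μ ν ρ₁ ρ₂ : Measure X) (φ ψ : X → ℝ) : ℝ :=
  -ε * (∫ z, (Real.exp ((φ z.1 + ψ z.2) / ε) - 1) * gibbs c ε z ∂(ρ₁.prod ρ₂))
    + ∫ x, min (φ x) (l₁ x : ℝ) ∂μ + ∫ y, min (ψ y) (l₂ y : ℝ) ∂ν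

/-- The dual problem: supremum of the dual objective over `φ ∈ L^∞(dx)`, `ψ ∈ L^∞(dy)` subject to
the constraints of the chosen penalties. -/
def dualEgopt (c : X × X → ℝ≥0) (ε : ℝ) (k₁ k₂ : Penalty) (l₁ l₂ : X → ℝ≥0)
    (μ ν ρ₁ ρ₂ : Measure X) : EReal :=
  ⨆ (φ : Lp ℝ ∞ ρ₁) (ψ : Lp ℝ ∞ ρ₂)
    (_ : (φ : X → ℝ) ∈ k₁.dualConstraint l₁ ρ₁) (_ : (ψ : X → ℝ) ∈ k₂.dualConstraint l₂ ρ₂),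
    ((dualObjective c ε l₁ l₂ μ ν ρ₁ ρ₂ φ ψ : ℝ) : EReal)

end

end EGOPT

/-!
Why duality holds. Write `m = dx ⊗ dy`, `w = φ ⊕ ψ` and `r = dγ/dm`.

Weak duality is pointwise. Young's inequality for the entropy (`neg_exp_le_transportEntropy`) gives
`c r + ε (r ln r - r) - w r ≥ -ε e^{(w - c)/ε}`, and each marginal penalty is bounded below by
`⟨min (φ, l), β⟩ - ⟨φ, α⟩` for admissible `φ` (`Penalty.integral_min_sub_le_cost`). Conversely each
penalty is the supremum of these expressions over bounded admissible potentials
(`Penalty.cost_le_of_forall_mem_box`), the extremal potentials being read off from a Hahn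
decomposition for `α` and `β`.

For strong duality, take admissible potentials in `[-n, n]` with `φ ≤ l₁`, `ψ ≤ l₂`; on this box
the dual functional is `J(φ, ψ) = ⟨φ, μ⟩ + ⟨ψ, ν⟩ - ε ⟨e^{(w - c)/ε}, m⟩`. No maximizer is needed:
since the second derivative of `J` is bounded on a box, a good enough near-maximizer `(φₙ, ψₙ)` has
slope at most `1 / (n + 1)` towards every point of the box (`exists_dualSlope_le`).
Let `rₙ = e^{(φₙ ⊕ ψₙ - c)/ε}`. The remainder in Young's inequality controls square roots of
densities, and yields `J(φᵢ, ψᵢ) + ε ‖√rⱼ - √rᵢ‖² ≤ J(φⱼ, ψⱼ) + 1 / (j + 1)` for `i ≤ j`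
(`dualValue_add_sq_le`). As `J` is bounded above, the `√rₙ` form a Cauchy sequence in `L²(m)`, and a
subsequence of `rₙ` converges almost everywhere to some `r`. For fixed bounded potentials the
integrand of the Lagrangian is bounded below, so Fatou's lemma bounds the Lagrangian at `r` by the
dual value, for all bounded potentials at once (`exists_density_lagrangian_le`). Taking the suprema
over `φ` and `ψ` turns the Lagrangian into the primal objective at `r m`.
-/

open scoped Topology

namespace EGOPT

/-! ### Jordan decomposition and weighted measures -/

section Penalties

variable {X : Type*} [MeasurableSpace X]

theorem add_sub_eq_add_sub (α β : Measure X) [IsFiniteMeasure α] [IsFiniteMeasure β] :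
    α + (β - α) = β + (α - β) := by
  have h := Measure.sub_toSignedMeasure_eq_toSignedMeasure_sub (μ := α) (ν := β)
  have h' : α.toSignedMeasure + (β - α).toSignedMeasure
      = β.toSignedMeasure + (α - β).toSignedMeasure := by
    rw [sub_eq_sub_iff_add_eq_add] at h
    rw [h, add_comm]
  rw [← Measure.toSignedMeasure_add, ← Measure.toSignedMeasure_add] at h'
  exact Measure.toSignedMeasure_eq_toSignedMeasure_iff.1 h'

theorem exists_sub_eq_zero (α β : Measure X) [IsFiniteMeasure α] [IsFiniteMeasure β] :
    ∃ s, MeasurableSet s ∧ (α - β) s = 0 ∧ (β - α) sᶜ = 0 := by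
  obtain ⟨s, hs⟩ := exists_isHahnDecomposition α β
  exact ⟨s, hs.measurableSet, Measure.sub_apply_eq_zero_of_isHahnDecomposition hs,
    Measure.sub_apply_eq_zero_of_isHahnDecomposition hs.compl⟩

/-- The Jordan decomposition is the only decomposition into mutually singular parts. -/
theorem sub_eq_of_add_eq_add {α β p q : Measure X} [IsFiniteMeasure α] [IsFiniteMeasure β]
    (h : α + p = β + q) {s : Set X} (hp : p sᶜ = 0) (hq : q s = 0) :
    β - α = p := by
  apply le_antisymm
  · apply Measure.sub_le_of_le_add
    rw [add_comm, h]
    exact Measure.le_add_right le_rfl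
  · rw [Measure.le_iff]
    intro t ht
    have h1 : p t ≤ p (t ∩ s) := by
      calc p t ≤ p ((t ∩ s) ∪ sᶜ) := measure_mono fun x hx => by
            by_cases hxs : x ∈ s
            · exact Or.inl ⟨hx, hxs⟩
            · exact Or.inr hxs
        _ ≤ p (t ∩ s) + p sᶜ := measure_union_le _ _
        _ = p (t ∩ s) := by rw [hp, add_zero]
    have h2 : α (t ∩ s) + p (t ∩ s) ≤ α (t ∩ s) + (β - α) (t ∩ s) := by
      calc α (t ∩ s) + p (t ∩ s) = (α + p) (t ∩ s) := rfl
        _ = β (t ∩ s) + q (t ∩ s) := by rw [h]; rfl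
        _ = β (t ∩ s) := by rw [measure_mono_null inter_subset_right hq, add_zero]
        _ ≤ (β + (α - β)) (t ∩ s) := le_self_add
        _ = α (t ∩ s) + (β - α) (t ∩ s) := by rw [← add_sub_eq_add_sub]; rfl
    exact h1.trans ((ENNReal.add_le_add_iff_left (measure_ne_top _ _)).1 h2 |>.trans
      (measure_mono inter_subset_left))

theorem isFiniteMeasure_weighted {l : X → ℝ≥0} {C : ℝ≥0} (hC : ∀ x, l x ≤ C)
    (α : Measure X) [IsFiniteMeasure α] : IsFiniteMeasure (weighted l α) := by
  apply isFiniteMeasure_withDensity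
  refine ((lintegral_mono (g := fun _ => (C : ℝ≥0∞)) fun x => by simpa using hC x).trans_lt ?_).ne
  rw [lintegral_const]
  exact ENNReal.mul_lt_top ENNReal.coe_lt_top (measure_lt_top _ _)

theorem weighted_sub_weighted {l : X → ℝ≥0} {C : ℝ≥0} (hC : ∀ x, l x ≤ C)
    (α β : Measure X) [IsFiniteMeasure α] [IsFiniteMeasure β] :
    weighted l β - weighted l α = weighted l (β - α) := by
  have := isFiniteMeasure_weighted hC α
  have := isFiniteMeasure_weighted hC β
  obtain ⟨s, hs, h1, h2⟩ := exists_sub_eq_zero α β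
  refine sub_eq_of_add_eq_add (q := weighted l (α - β)) ?_
    (withDensity_absolutelyContinuous _ _ h2) (withDensity_absolutelyContinuous _ _ h1)
  simp only [weighted]
  rw [← withDensity_add_measure, ← withDensity_add_measure, add_sub_eq_add_sub]

variable {l : X → ℝ≥0} {C : ℝ≥0}

theorem integrable_weight (hl : Measurable l) (hC : ∀ x, l x ≤ C) (α : Measure X)
    [IsFiniteMeasure α] : Integrable (fun x => (l x : ℝ)) α :=
  Integrable.of_bound (by fun_prop) C (ae_of_all _ fun x => by simpa using hC x)

theorem weighted_univ (hl : Measurable l) (hC : ∀ x, l x ≤ C) (α : Measure X)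
    [IsFiniteMeasure α] : weighted l α univ = ENNReal.ofReal (∫ x, (l x : ℝ) ∂α) := by
  rw [ofReal_integral_eq_lintegral_ofReal (integrable_weight hl hC α)
    (ae_of_all _ fun x => (l x).coe_nonneg)]
  simp [weighted]

theorem tvDist_weighted (hl : Measurable l) (hC : ∀ x, l x ≤ C) (α β : Measure X)
    [IsFiniteMeasure α] [IsFiniteMeasure β] :
    tvDist (weighted l α) (weighted l β)
      = ENNReal.ofReal (∫ x, (l x : ℝ) ∂(β - α) + ∫ x, (l x : ℝ) ∂(α - β)) := by
  rw [tvDist, weighted_sub_weighted hC, weighted_sub_weighted hC, weighted_univ hl hC,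
    weighted_univ hl hC, ENNReal.ofReal_add (by positivity) (by positivity), add_comm]

/-! ### Duality for the marginal penalties -/

/-- Both penalties are at least the weighted total variation. -/
theorem Penalty.tvDist_le_cost (k : Penalty) (l : X → ℝ≥0) (α β : Measure X) :
    tvDist (weighted l α) (weighted l β) ≤ k.cost l α β := by
  cases k
  · exact le_rfl
  · simp only [Penalty.cost, ptvDist]
    exact le_self_add.trans le_self_add

theorem Penalty.cost_of_le (k : Penalty) (l : X → ℝ≥0) {α β : Measure X} (h : α ≤ β) :
    k.cost l α β = tvDist (weighted l α) (weighted l β) := by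
  have h' : weighted l α ≤ weighted l β := Measure.le_iff.2 fun t ht => by
    rw [weighted, weighted, withDensity_apply _ ht, withDensity_apply _ ht]
    exact lintegral_mono' (Measure.restrict_mono le_rfl h) le_rfl
  cases k
  · rfl
  · simp [Penalty.cost, ptvDist, leIndicator, h, h']

theorem Penalty.cost_ptvBar_of_not_le {α β : Measure X} (h : ¬ α ≤ β) :
    Penalty.ptvBar.cost l α β = ∞ := by
  simp [Penalty.cost, leIndicator, h]

theorem integral_sub_integral_eq_jordan {g : X → ℝ} {α β : Measure X} [IsFiniteMeasure α]
    [IsFiniteMeasure β] (hα : Integrable g α) (hβ : Integrable g β) :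
    ∫ x, g x ∂β - ∫ x, g x ∂α = ∫ x, g x ∂(β - α) - ∫ x, g x ∂(α - β) := by
  have h := congrArg (fun m => ∫ x, g x ∂m) (add_sub_eq_add_sub α β)
  rw [integral_add_measure hα (hβ.mono_measure Measure.sub_le),
    integral_add_measure hβ (hα.mono_measure Measure.sub_le)] at h
  linarith

/-- Weak duality for a marginal penalty: an admissible potential bounds the penalty from below.
Only the lower bound `-l ≤ φ` of the `TV` constraint matters here. -/
theorem Penalty.integral_min_sub_le_cost (k : Penalty) (hl : Measurable l) (hC : ∀ x, l x ≤ C)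
    {α β : Measure X} [IsFiniteMeasure α] [IsFiniteMeasure β] {φ : X → ℝ}
    (hα : Integrable φ α) (hβ : Integrable φ β)
    (hkα : k = .tv → ∀ᵐ x ∂α, -(l x : ℝ) ≤ φ x) :
    ((∫ x, min (φ x) (l x : ℝ) ∂β - ∫ x, φ x ∂α : ℝ) : EReal) ≤ (k.cost l α β : EReal) := by
  have hlα := integrable_weight hl hC α
  have hlβ := integrable_weight hl hC β
  have hgα : Integrable (fun x => min (φ x) (l x : ℝ)) α := hα.inf hlα
  have hgβ : Integrable (fun x => min (φ x) (l x : ℝ)) β := hβ.inf hlβ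
  by_cases hbad : k = .ptvBar ∧ ¬ α ≤ β
  · rw [hbad.1, Penalty.cost_ptvBar_of_not_le hbad.2]
    exact le_top
  have key : ∫ x, min (φ x) (l x : ℝ) ∂β - ∫ x, φ x ∂α
      ≤ ∫ x, (l x : ℝ) ∂(β - α) + ∫ x, (l x : ℝ) ∂(α - β) := by
    have h1 : ∫ x, min (φ x) (l x : ℝ) ∂α ≤ ∫ x, φ x ∂α :=
      integral_mono hgα hα fun x => min_le_left _ _
    have h2 := integral_sub_integral_eq_jordan hgα hgβ
    have h3 : ∫ x, min (φ x) (l x : ℝ) ∂(β - α) ≤ ∫ x, (l x : ℝ) ∂(β - α) :=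
      integral_mono (hgβ.mono_measure Measure.sub_le) (hlβ.mono_measure Measure.sub_le)
        fun x => min_le_right _ _
    have h4 : -∫ x, (l x : ℝ) ∂(α - β) ≤ ∫ x, min (φ x) (l x : ℝ) ∂(α - β) := by
      cases k with
      | tv =>
        rw [← integral_neg]
        refine integral_mono_ae (hlα.mono_measure Measure.sub_le).neg
          (hgα.mono_measure Measure.sub_le) ?_
        filter_upwards [Measure.absolutelyContinuous_of_le Measure.sub_le (hkα rfl)] with x hx
        exact le_min hx (by linarith [(l x).coe_nonneg])
      | ptvBar =>
        have h : α ≤ β := by simpa using hbad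
        simp [Measure.sub_eq_zero_of_le h]
    linarith
  calc ((∫ x, min (φ x) (l x : ℝ) ∂β - ∫ x, φ x ∂α : ℝ) : EReal)
      ≤ ((∫ x, (l x : ℝ) ∂(β - α) + ∫ x, (l x : ℝ) ∂(α - β) : ℝ) : EReal) := by exact_mod_cast key
    _ ≤ ((tvDist (weighted l α) (weighted l β) : ℝ≥0∞) : EReal) := by
      rw [tvDist_weighted hl hC, EReal.coe_ennreal_ofReal]
      exact_mod_cast le_max_left _ _
    _ ≤ (k.cost l α β : EReal) := by exact_mod_cast k.tvDist_le_cost l α β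

/-- The bounded admissible potentials of a marginal penalty with values in `[-n, n]`. The bound
`φ ≤ l` loses nothing, since the dual objective sees `min (φ, l)` only, and the other term improves
when `φ` decreases. -/
def Penalty.box (k : Penalty) (l : X → ℝ≥0) (n : ℝ) : Set (X → ℝ) :=
  {φ | Measurable φ ∧ (∀ x, |φ x| ≤ n) ∧ (∀ x, φ x ≤ l x) ∧ (k = .tv → ∀ x, -(l x : ℝ) ≤ φ x)}

theorem Penalty.zero_mem_box (k : Penalty) (l : X → ℝ≥0) {n : ℝ} (hn : 0 ≤ n) :
    (fun _ => 0) ∈ k.box l n :=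
  ⟨measurable_const, fun _ => by simpa using hn, by simp, by simp⟩

theorem Penalty.box_mono (k : Penalty) (l : X → ℝ≥0) {m n : ℝ} (h : m ≤ n) :
    k.box l m ⊆ k.box l n :=
  fun _ hφ => ⟨hφ.1, fun x => (hφ.2.1 x).trans h, hφ.2.2⟩

theorem Penalty.convex_box (k : Penalty) (l : X → ℝ≥0) (n : ℝ) : Convex ℝ (k.box l n) := by
  intro φ hφ ψ hψ a b ha hb hab
  refine ⟨(hφ.1.const_smul a).add (hψ.1.const_smul b), fun x => ?_, fun x => ?_, fun h x => ?_⟩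
  · have h1 := abs_le.1 (hφ.2.1 x)
    have h2 := abs_le.1 (hψ.2.1 x)
    simp only [Pi.add_apply, Pi.smul_apply, smul_eq_mul]
    obtain rfl : b = 1 - a := by linarith
    exact abs_le.2 ⟨by nlinarith, by nlinarith⟩
  · have h1 := hφ.2.2.1 x
    have h2 := hψ.2.2.1 x
    simp only [Pi.add_apply, Pi.smul_apply, smul_eq_mul]
    obtain rfl : b = 1 - a := by linarith
    nlinarith
  · have h1 := hφ.2.2.2 h x
    have h2 := hψ.2.2.2 h x
    simp only [Pi.add_apply, Pi.smul_apply, smul_eq_mul]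
    obtain rfl : b = 1 - a := by linarith
    nlinarith

theorem Penalty.integrable_of_mem_box {k : Penalty} {n : ℝ} {φ : X → ℝ}
    (hφ : φ ∈ k.box l n) (α : Measure X) [IsFiniteMeasure α] : Integrable φ α :=
  Integrable.of_bound hφ.1.aestronglyMeasurable n (ae_of_all _ hφ.2.1)

theorem Penalty.mem_dualConstraint_of_mem_box {k : Penalty} {n : ℝ} {φ : X → ℝ}
    (hφ : φ ∈ k.box l n) (hl : Measurable l) (ρ : Measure X) : φ ∈ k.dualConstraint l ρ := by
  cases k with
  | ptvBar => trivial
  | tv =>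
    refine ⟨ae_of_all _ (hφ.2.2.2 rfl), ?_⟩
    refine (ae_restrict_iff' (hl (measurableSet_singleton 0))).2 (ae_of_all _ fun x hx => ?_)
    have h1 := hφ.2.2.1 x
    have h2 := hφ.2.2.2 rfl x
    have h0 : l x = 0 := hx
    rw [h0] at h1 h2
    simp only [NNReal.coe_zero, neg_zero] at h1 h2
    exact le_antisymm h1 h2

theorem Penalty.dualConstraint_congr (k : Penalty) (l : X → ℝ≥0) {ρ : Measure X} {φ φ' : X → ℝ}
    (h : φ =ᵐ[ρ] φ') (hφ : φ ∈ k.dualConstraint l ρ) : φ' ∈ k.dualConstraint l ρ := by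
  cases k with
  | ptvBar => trivial
  | tv =>
    refine ⟨?_, ?_⟩
    · filter_upwards [h, hφ.1] with x hx hx'
      rwa [← hx]
    · filter_upwards [ae_restrict_of_ae h, hφ.2] with x hx hx'
      rwa [← hx]

/-- Strong duality for a marginal penalty. The extremal potential is `l` on the set where `α ≤ β`;
on the complement it is `-l` for `TV` and a large negative constant for `PTV-bar`. -/
theorem Penalty.cost_le_of_forall_mem_box (k : Penalty) (hl : Measurable l) (hC : ∀ x, l x ≤ C)
    {α β : Measure X} [IsFiniteMeasure α] [IsFiniteMeasure β] {M : ℝ}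
    (h : ∀ n : ℝ, ∀ φ ∈ k.box l n, ∫ x, φ x ∂β - ∫ x, φ x ∂α ≤ M) :
    k.cost l α β ≤ ENNReal.ofReal M := by
  classical
  obtain ⟨s, hs, h1, h2⟩ := exists_sub_eq_zero α β
  have hle : ∀ x, (l x : ℝ) ≤ C := fun x => by exact_mod_cast hC x
  -- the bound given by the potential equal to `l` on `s` and to `-a` on the complement of `s`
  have value : ∀ (a : X → ℝ≥0) (n : ℝ≥0), Measurable a → (∀ x, a x ≤ n) →
      (k = .tv → ∀ x, a x ≤ l x) →
      ∫ x, (l x : ℝ) ∂(β - α) + ∫ x, (a x : ℝ) ∂(α - β) ≤ M := by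
    intro a n ha han hak
    have hmem : (fun x => if x ∈ s then (l x : ℝ) else -(a x : ℝ)) ∈ k.box l (C + n) := by
      refine ⟨Measurable.ite hs (by fun_prop) (by fun_prop), fun x => ?_, fun x => ?_,
        fun hk x => ?_⟩
      · have : (a x : ℝ) ≤ n := by exact_mod_cast han x
        have := hle x
        have := n.coe_nonneg
        have := C.coe_nonneg
        dsimp only
        split_ifs
        · rw [abs_of_nonneg (l x).coe_nonneg]; linarith
        · rw [abs_neg, abs_of_nonneg (a x).coe_nonneg]; linarith
      · dsimp only
        split_ifs
        · exact le_rfl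
        · linarith [(l x).coe_nonneg, (a x).coe_nonneg]
      · dsimp only
        split_ifs
        · linarith [(l x).coe_nonneg]
        · exact neg_le_neg (by exact_mod_cast hak hk x)
    have h3 := h _ _ hmem
    rw [integral_sub_integral_eq_jordan (integrable_of_mem_box hmem α)
      (integrable_of_mem_box hmem β)] at h3
    have e1 : ∫ x, (if x ∈ s then (l x : ℝ) else -(a x : ℝ)) ∂(β - α)
        = ∫ x, (l x : ℝ) ∂(β - α) := by
      refine integral_congr_ae ?_
      filter_upwards [compl_mem_ae_iff.2 h2] with x hx
      simp [not_not.1 hx]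
    have e2 : ∫ x, (if x ∈ s then (l x : ℝ) else -(a x : ℝ)) ∂(α - β)
        = -∫ x, (a x : ℝ) ∂(α - β) := by
      rw [← integral_neg]
      refine integral_congr_ae ?_
      filter_upwards [compl_mem_ae_iff.2 h1] with x hx
      rw [if_neg hx]
    rw [e1, e2] at h3
    linarith
  cases k with
  | tv =>
    simp only [Penalty.cost]
    rw [tvDist_weighted hl hC]
    exact ENNReal.ofReal_le_ofReal (value l C hl hC fun _ _ => le_rfl)
  | ptvBar =>
    -- letting the constant tend to infinity shows that `α - β` has no mass
    have hmass : (α - β).real univ = 0 := by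
      by_contra hne
      have hpos : 0 < (α - β).real univ := lt_of_le_of_ne measureReal_nonneg (Ne.symm hne)
      have hv := value (fun _ => Real.toNNReal ((|M| + 1) / (α - β).real univ)) _ measurable_const
        (fun _ => le_rfl) (fun hk => by cases hk)
      rw [integral_const, smul_eq_mul, Real.coe_toNNReal _ (by positivity),
        mul_div_cancel₀ _ hpos.ne'] at hv
      have h0 : 0 ≤ ∫ x, (l x : ℝ) ∂(β - α) := integral_nonneg fun x => (l x).coe_nonneg
      linarith [le_abs_self M]
    have hzero : α - β = 0 := by
      rw [← Measure.measure_univ_eq_zero]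
      simpa [measureReal_def, ENNReal.toReal_eq_zero_iff] using hmass
    have hαβ : α ≤ β := by
      have h4 := add_sub_eq_add_sub α β
      rw [hzero, add_zero] at h4
      rw [← h4]
      exact Measure.le_add_right le_rfl
    rw [Penalty.cost_of_le _ _ hαβ, tvDist_weighted hl hC]
    refine ENNReal.ofReal_le_ofReal ?_
    have := value l C hl hC (fun hk => by cases hk)
    exact this

end Penalties

/-! ### Legendre duality of the entropy -/

/-- The integrand `c s + ε (s ln s - s)` of transport cost plus entropy, at cost `c` and density
`s`. -/
noncomputable def transportEntropy (c ε s : ℝ) : ℝ := c * s + ε * (s * Real.log s - s)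

/-- Young's inequality for the entropy, with a quadratic remainder in the square roots of the
densities. -/
theorem sq_sqrt_sub_le_transportEntropy {ε : ℝ} (hε : 0 < ε) (c t : ℝ) {s : ℝ} (hs : 0 ≤ s) :
    ε * (√s - √(Real.exp ((t - c) / ε))) ^ 2
      ≤ transportEntropy c ε s - t * s + ε * Real.exp ((t - c) / ε) := by
  rw [transportEntropy]
  set r := Real.exp ((t - c) / ε) with hr
  have hr0 : 0 < r := Real.exp_pos _
  have hlog : t - c = ε * Real.log r := by
    rw [hr, Real.log_exp]
    field_simp
  have key : √s ^ 2 - 2 * √s * √r + √r ^ 2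
      ≤ s * Real.log s - s - s * Real.log r + r := by
    rw [Real.sq_sqrt hs, Real.sq_sqrt hr0.le]
    rcases hs.eq_or_lt with rfl | hs
    · simp
    have h1 : Real.log (√r / √s) ≤ √r / √s - 1 :=
      Real.log_le_sub_one_of_pos (div_pos (Real.sqrt_pos.2 hr0) (Real.sqrt_pos.2 hs))
    rw [Real.log_div (Real.sqrt_pos.2 hr0).ne' (Real.sqrt_pos.2 hs).ne', Real.log_sqrt hr0.le,
      Real.log_sqrt hs.le] at h1
    have h2 : s * (√r / √s) = √s * √r := by
      have : √s ≠ 0 := (Real.sqrt_pos.2 hs).ne'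
      nth_rewrite 1 [← Real.mul_self_sqrt hs.le]
      field_simp
    nlinarith [mul_le_mul_of_nonneg_left h1 hs.le]
  have := mul_le_mul_of_nonneg_left key hε.le
  have h3 : (t - c) * s = ε * Real.log r * s := by rw [hlog]
  nlinarith

theorem neg_exp_le_transportEntropy {ε : ℝ} (hε : 0 < ε) (c t : ℝ) {s : ℝ} (hs : 0 ≤ s) :
    -(ε * Real.exp ((t - c) / ε)) ≤ transportEntropy c ε s - t * s := by
  have h1 := sq_sqrt_sub_le_transportEntropy hε c t hs
  have h2 : 0 ≤ ε * (√s - √(Real.exp ((t - c) / ε))) ^ 2 := by positivity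
  linarith

theorem transportEntropy_exp {ε : ℝ} (hε : 0 < ε) (c t : ℝ) :
    transportEntropy c ε (Real.exp ((t - c) / ε)) = (t - ε) * Real.exp ((t - c) / ε) := by
  rw [transportEntropy, Real.log_exp]
  field_simp
  ring

theorem continuous_transportEntropy (c ε : ℝ) : Continuous (transportEntropy c ε) := by
  unfold transportEntropy
  have := Real.continuous_mul_log
  fun_prop

/-! ### Two limit theorems for integrals -/

section Limits

variable {Z : Type*} [MeasurableSpace Z]

/-- Fatou's lemma for Bochner integrals of nonnegative functions. -/
theorem integrable_and_integral_le_of_tendsto {m : Measure Z} {g : ℕ → Z → ℝ} {g' : Z → ℝ}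
    {δ : ℕ → ℝ} {K : ℝ} (hg0 : ∀ i z, 0 ≤ g i z) (hgi : ∀ i, Integrable (g i) m)
    (hlim : ∀ᵐ z ∂m, Tendsto (fun i => g i z) atTop (𝓝 (g' z)))
    (hδ : Tendsto δ atTop (𝓝 0)) (hK : ∀ i, ∫ z, g i z ∂m ≤ K + δ i) :
    Integrable g' m ∧ ∫ z, g' z ∂m ≤ K := by
  have hKδ : Tendsto (fun i => K + δ i) atTop (𝓝 K) := by simpa using hδ.const_add K
  have hK0 : 0 ≤ K :=
    ge_of_tendsto' hKδ fun i => (integral_nonneg (hg0 i)).trans (hK i)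
  have hmeas : AEStronglyMeasurable g' m :=
    aestronglyMeasurable_of_tendsto_ae atTop (fun i => (hgi i).aestronglyMeasurable) hlim
  have hg'0 : 0 ≤ᵐ[m] g' := by
    filter_upwards [hlim] with z hz
    exact ge_of_tendsto' hz fun i => hg0 i z
  have hfatou : ∫⁻ z, ENNReal.ofReal (g' z) ∂m ≤ ENNReal.ofReal K := by
    calc ∫⁻ z, ENNReal.ofReal (g' z) ∂m
        = ∫⁻ z, liminf (fun i => ENNReal.ofReal (g i z)) atTop ∂m := by
          refine lintegral_congr_ae ?_
          filter_upwards [hlim] with z hz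
          exact ((ENNReal.continuous_ofReal.tendsto _).comp hz).liminf_eq.symm
      _ ≤ liminf (fun i => ∫⁻ z, ENNReal.ofReal (g i z) ∂m) atTop :=
          lintegral_liminf_le' fun i => (hgi i).aemeasurable.ennreal_ofReal
      _ ≤ liminf (fun i => ENNReal.ofReal (K + δ i)) atTop := by
          refine liminf_le_liminf (Eventually.of_forall fun i => ?_)
          rw [← ofReal_integral_eq_lintegral_ofReal (hgi i) (ae_of_all _ (hg0 i))]
          exact ENNReal.ofReal_le_ofReal (hK i)
      _ = ENNReal.ofReal K := ((ENNReal.continuous_ofReal.tendsto _).comp hKδ).liminf_eq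
  have hint : Integrable g' m :=
    (lintegral_ofReal_ne_top_iff_integrable hmeas hg'0).1
      (hfatou.trans_lt ENNReal.ofReal_lt_top).ne
  refine ⟨hint, (ENNReal.ofReal_le_ofReal_iff hK0).1 ?_⟩
  rwa [ofReal_integral_eq_lintegral_ofReal hint hg'0]

/-- A Cauchy sequence in `L²` has an almost everywhere convergent subsequence. -/
theorem exists_subseq_tendsto_ae_of_cauchy {m : Measure Z} {f : ℕ → Z → ℝ}
    (hf : ∀ i, MemLp (f i) 2 m)
    (hc : ∀ τ > 0, ∃ N, ∀ i ≥ N, ∀ j ≥ i, ∫ z, (f j z - f i z) ^ 2 ∂m ≤ τ) :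
    ∃ (F : Z → ℝ) (ns : ℕ → ℕ), Measurable F ∧ StrictMono ns ∧
      ∀ᵐ z ∂m, Tendsto (fun i => f (ns i) z) atTop (𝓝 (F z)) := by
  have hnorm : ∀ i j, dist ((hf j).toLp (f j)) ((hf i).toLp (f i)) ^ 2
      = ∫ z, (f j z - f i z) ^ 2 ∂m := by
    intro i j
    rw [dist_eq_norm, ← MemLp.toLp_sub, ← real_inner_self_eq_norm_sq, L2.inner_def]
    refine integral_congr_ae ?_
    filter_upwards [((hf j).sub (hf i)).coeFn_toLp] with z hz
    rw [hz]
    simp [pow_two]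
  have hcau : CauchySeq fun i => (hf i).toLp (f i) := by
    rw [Metric.cauchySeq_iff']
    intro τ hτ
    obtain ⟨N, hN⟩ := hc ((τ / 2) ^ 2) (by positivity)
    refine ⟨N, fun j hj => ?_⟩
    have h1 := hN N le_rfl j hj
    rw [← hnorm] at h1
    have := abs_le_of_sq_le_sq h1 (by positivity)
    rw [abs_of_nonneg dist_nonneg] at this
    linarith
  obtain ⟨F, hF⟩ := cauchySeq_tendsto_of_complete hcau
  obtain ⟨ns, hns, hae⟩ := (tendstoInMeasure_of_tendsto_Lp hF).exists_seq_tendsto_ae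
  refine ⟨F, ns, (Lp.stronglyMeasurable F).measurable, hns, ?_⟩
  have hall : ∀ᵐ z ∂m, ∀ i, (hf i).toLp (f i) z = f i z :=
    ae_all_iff.2 fun i => (hf i).coeFn_toLp
  filter_upwards [hae, hall] with z hz hz'
  simpa [hz'] using hz

end Limits

/-! ### Almost stationary potentials -/

section Dual

variable {X : Type*} [MeasurableSpace X]

/-- The density `e^{(φ ⊕ ψ - c)/ε}` of the plan induced by a pair of potentials. -/
noncomputable def planDensity (c : X × X → ℝ≥0) (ε : ℝ) (φ ψ : X → ℝ) (z : X × X) : ℝ :=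
  Real.exp ((φ z.1 + ψ z.2 - c z) / ε)

/-- The dual functional `⟨φ, μ⟩ + ⟨ψ, ν⟩ - ε ⟨e^{(φ ⊕ ψ - c)/ε}, m⟩` without truncation of the
potentials and without additive constant. -/
noncomputable def dualValue (c : X × X → ℝ≥0) (ε : ℝ) (μ ν : Measure X) (m : Measure (X × X))
    (φ ψ : X → ℝ) : ℝ :=
  ∫ x, φ x ∂μ + ∫ y, ψ y ∂ν - ε * ∫ z, planDensity c ε φ ψ z ∂m

/-- The derivative of `dualValue` at `(φ, ψ)` along the segment towards
`(φ', ψ')`. -/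
noncomputable def dualSlope (c : X × X → ℝ≥0) (ε : ℝ) (μ ν : Measure X) (m : Measure (X × X))
    (φ ψ φ' ψ' : X → ℝ) : ℝ :=
  (∫ x, φ' x ∂μ - ∫ x, φ x ∂μ) + (∫ y, ψ' y ∂ν - ∫ y, ψ y ∂ν)
    - ∫ z, (φ' z.1 + ψ' z.2 - (φ z.1 + ψ z.2)) * planDensity c ε φ ψ z ∂m

variable {c : X × X → ℝ≥0} {ε : ℝ} {l₁ l₂ : X → ℝ≥0} {k₁ k₂ : Penalty}

theorem planDensity_pos {X : Type*} (c : X × X → ℝ≥0) (ε : ℝ) (φ ψ : X → ℝ) (z : X × X) :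
    0 < planDensity c ε φ ψ z := Real.exp_pos _

theorem measurable_planDensity (hc : Measurable c) {φ ψ : X → ℝ} (hφ : Measurable φ)
    (hψ : Measurable ψ) : Measurable (planDensity c ε φ ψ) := by
  unfold planDensity
  fun_prop

theorem abs_add_le_of_mem_box {n : ℝ} {φ ψ : X → ℝ} (hφ : φ ∈ k₁.box l₁ n)
    (hψ : ψ ∈ k₂.box l₂ n) (z : X × X) : |φ z.1 + ψ z.2| ≤ 2 * n :=
  (abs_add_le _ _).trans (by linarith [hφ.2.1 z.1, hψ.2.1 z.2])

theorem planDensity_le (hε : 0 < ε) {n : ℝ} {φ ψ : X → ℝ} (hφ : φ ∈ k₁.box l₁ n)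
    (hψ : ψ ∈ k₂.box l₂ n) (z : X × X) : planDensity c ε φ ψ z ≤ Real.exp (2 * n / ε) := by
  refine Real.exp_le_exp.2 (div_le_div_of_nonneg_right ?_ hε.le)
  have := abs_le.1 (abs_add_le_of_mem_box hφ hψ z)
  linarith [(c z).coe_nonneg]

theorem integrable_add_mul (m : Measure (X × X)) {N : ℝ} {φ' ψ' : X → ℝ} (hφ' : φ' ∈ k₁.box l₁ N)
    (hψ' : ψ' ∈ k₂.box l₂ N) {s : X × X → ℝ} (hs : Integrable s m) :
    Integrable (fun z => (φ' z.1 + ψ' z.2) * s z) m :=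
  hs.bdd_mul
    ((hφ'.1.comp measurable_fst).add (hψ'.1.comp measurable_snd)).aestronglyMeasurable
    (ae_of_all _ (abs_add_le_of_mem_box hφ' hψ'))

variable (m : Measure (X × X)) [IsProbabilityMeasure m]

theorem integrable_planDensity (hc : Measurable c) (hε : 0 < ε) {n : ℝ} {φ ψ : X → ℝ}
    (hφ : φ ∈ k₁.box l₁ n) (hψ : ψ ∈ k₂.box l₂ n) : Integrable (planDensity c ε φ ψ) m :=
  Integrable.of_bound (measurable_planDensity hc hφ.1 hψ.1).aestronglyMeasurable
    (Real.exp (2 * n / ε)) (ae_of_all _ fun z => by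
      rw [Real.norm_of_nonneg (planDensity_pos ..).le]
      exact planDensity_le hε hφ hψ z)

variable (μ ν : Measure X)

/-- Value of the Lagrangian, at the plan induced by `(φ, ψ)`, for the potentials `(φ', ψ')`. -/
theorem integral_transportEntropy_planDensity (hc : Measurable c) (hε : 0 < ε) {n N : ℝ}
    {φ ψ φ' ψ' : X → ℝ} (hφ : φ ∈ k₁.box l₁ n) (hψ : ψ ∈ k₂.box l₂ n)
    (hφ' : φ' ∈ k₁.box l₁ N) (hψ' : ψ' ∈ k₂.box l₂ N) :
    Integrable (fun z => transportEntropy (c z) ε (planDensity c ε φ ψ z)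
        - (φ' z.1 + ψ' z.2) * planDensity c ε φ ψ z) m ∧
    ∫ z, (transportEntropy (c z) ε (planDensity c ε φ ψ z)
        - (φ' z.1 + ψ' z.2) * planDensity c ε φ ψ z) ∂m + ∫ x, φ' x ∂μ + ∫ y, ψ' y ∂ν
      = dualValue c ε μ ν m φ ψ + dualSlope c ε μ ν m φ ψ φ' ψ' := by
  have hr := integrable_planDensity m hc hε hφ hψ
  have hw := integrable_add_mul m hφ hψ hr
  have hw' := integrable_add_mul m hφ' hψ' hr
  have heq : (fun z => transportEntropy (c z) ε (planDensity c ε φ ψ z)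
        - (φ' z.1 + ψ' z.2) * planDensity c ε φ ψ z)
      = fun z => (φ z.1 + ψ z.2) * planDensity c ε φ ψ z - ε * planDensity c ε φ ψ z
        - (φ' z.1 + ψ' z.2) * planDensity c ε φ ψ z := by
    funext z
    have := transportEntropy_exp hε (c z) (φ z.1 + ψ z.2)
    rw [← planDensity] at this
    rw [this]
    ring
  rw [heq]
  have hs : Integrable (fun z => (φ z.1 + ψ z.2) * planDensity c ε φ ψ z
      - ε * planDensity c ε φ ψ z) m := hw.sub (hr.const_mul ε)
  refine ⟨hs.sub hw', ?_⟩
  rw [integral_sub hs hw', integral_sub hw (hr.const_mul ε),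
    integral_const_mul, dualValue, dualSlope]
  simp only [sub_mul]
  rw [integral_sub hw' hw]
  ring

/-- Strong concavity of the dual functional in terms of the square roots of the plans. -/
theorem dualValue_add_sq_le (hc : Measurable c) (hε : 0 < ε) {n N : ℝ}
    {φ ψ φ' ψ' : X → ℝ} (hφ : φ ∈ k₁.box l₁ n) (hψ : ψ ∈ k₂.box l₂ n)
    (hφ' : φ' ∈ k₁.box l₁ N) (hψ' : ψ' ∈ k₂.box l₂ N) :
    dualValue c ε μ ν m φ' ψ'
        + ε * ∫ z, (√(planDensity c ε φ ψ z) - √(planDensity c ε φ' ψ' z)) ^ 2 ∂m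
      ≤ dualValue c ε μ ν m φ ψ + dualSlope c ε μ ν m φ ψ φ' ψ' := by
  obtain ⟨hi, he⟩ := integral_transportEntropy_planDensity m μ ν hc hε hφ hψ hφ' hψ'
  have hr' := integrable_planDensity m hc hε hφ' hψ'
  have hmono : ∫ z, ε * (√(planDensity c ε φ ψ z) - √(planDensity c ε φ' ψ' z)) ^ 2 ∂m
      ≤ ∫ z, ((transportEntropy (c z) ε (planDensity c ε φ ψ z)
        - (φ' z.1 + ψ' z.2) * planDensity c ε φ ψ z) + ε * planDensity c ε φ' ψ' z) ∂m := by
    refine integral_mono_of_nonneg (ae_of_all _ fun z => by positivity)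
      (hi.add (hr'.const_mul ε)) (ae_of_all _ fun z => ?_)
    exact sq_sqrt_sub_le_transportEntropy hε (c z) (φ' z.1 + ψ' z.2) (planDensity_pos c ε φ ψ z).le
  rw [integral_const_mul, integral_add hi (hr'.const_mul ε), integral_const_mul] at hmono
  rw [← he, dualValue]
  linarith

variable [IsFiniteMeasure μ] [IsFiniteMeasure ν]

/-- On every box the dual functional has almost stationary points: a sufficiently good
near-maximizer works, because the second derivative of the functional is bounded on the box. -/
theorem exists_dualSlope_le (hc : Measurable c) (hε : 0 < ε) {n δ : ℝ} (hn : 0 ≤ n) (hδ : 0 < δ) :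
    ∃ φ ∈ k₁.box l₁ n, ∃ ψ ∈ k₂.box l₂ n, ∀ φ' ∈ k₁.box l₁ n, ∀ ψ' ∈ k₂.box l₂ n,
      dualSlope c ε μ ν m φ ψ φ' ψ' ≤ δ := by
  set D : ℝ := 4 * (n + 1) with hD
  have hD0 : 0 < D := by positivity
  set A : ℝ := Real.exp (2 * n / ε) * D ^ 2 / ε with hA
  have hA0 : 0 < A := by positivity
  -- step length `t` at which the quadratic error `t ^ 2 * A` is at most `t * δ / 2`
  obtain ⟨t, ht0, ht1, htD, htA⟩ : ∃ t : ℝ, 0 < t ∧ t ≤ 1 ∧ t * D ≤ ε ∧ t * A ≤ δ / 2 := by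
    refine ⟨min 1 (min (ε / D) (δ / 2 / A)), by positivity, min_le_left _ _, ?_, ?_⟩
    · exact (le_div_iff₀ hD0).1 ((min_le_right _ _).trans (min_le_left _ _))
    · exact (le_div_iff₀ hA0).1 ((min_le_right _ _).trans (min_le_right _ _))
  set S : Set ℝ := {v | ∃ φ ∈ k₁.box l₁ n, ∃ ψ ∈ k₂.box l₂ n, v = dualValue c ε μ ν m φ ψ}
    with hS
  have hSne : S.Nonempty :=
    ⟨_, _, k₁.zero_mem_box l₁ hn, _, k₂.zero_mem_box l₂ hn, rfl⟩
  have hSbdd : BddAbove S := by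
    refine ⟨n * μ.real univ + n * ν.real univ, ?_⟩
    rintro v ⟨φ, hφ, ψ, hψ, rfl⟩
    have h1 : ∫ x, φ x ∂μ ≤ n * μ.real univ := by
      have := integral_mono (Penalty.integrable_of_mem_box hφ μ) (integrable_const n)
        fun x => (abs_le.1 (hφ.2.1 x)).2
      simpa [mul_comm] using this
    have h2 : ∫ x, ψ x ∂ν ≤ n * ν.real univ := by
      have := integral_mono (Penalty.integrable_of_mem_box hψ ν) (integrable_const n)
        fun x => (abs_le.1 (hψ.2.1 x)).2
      simpa [mul_comm] using this
    have h3 : 0 ≤ ε * ∫ z, planDensity c ε φ ψ z ∂m :=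
      mul_nonneg hε.le (integral_nonneg fun z => (planDensity_pos ..).le)
    rw [dualValue]
    linarith
  obtain ⟨_, ⟨φ, hφ, ψ, hψ, rfl⟩, hnear⟩ :=
    exists_lt_of_lt_csSup hSne (show sSup S - t * δ / 2 < sSup S by
      have : 0 < t * δ / 2 := by positivity
      linarith)
  refine ⟨φ, hφ, ψ, hψ, fun φ' hφ' ψ' hψ' => ?_⟩
  -- compare with the point at parameter `t` on the segment from `(φ, ψ)` to `(φ', ψ')`
  have hφt := k₁.convex_box l₁ n hφ hφ' (sub_nonneg.2 ht1) ht0.le (by ring)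
  have hψt := k₂.convex_box l₂ n hψ hψ' (sub_nonneg.2 ht1) ht0.le (by ring)
  have hle := (le_csSup hSbdd ⟨_, hφt, _, hψt, rfl⟩).trans (sub_le_iff_le_add.1 hnear.le)
  have hr := integrable_planDensity m hc hε hφ hψ
  have hΔr : Integrable (fun z => (φ' z.1 + ψ' z.2 - (φ z.1 + ψ z.2)) * planDensity c ε φ ψ z) m := by
    simp only [sub_mul]
    exact (integrable_add_mul m hφ' hψ' hr).sub (integrable_add_mul m hφ hψ hr)
  have hexp : ∀ z, ε * planDensity c ε ((1 - t) • φ + t • φ') ((1 - t) • ψ + t • ψ') z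
      ≤ ε * planDensity c ε φ ψ z
        + t * ((φ' z.1 + ψ' z.2 - (φ z.1 + ψ z.2)) * planDensity c ε φ ψ z) + t ^ 2 * A := by
    intro z
    set Δ := φ' z.1 + ψ' z.2 - (φ z.1 + ψ z.2) with hΔ
    have hΔD : |Δ| ≤ D := by
      have h1 := abs_le.1 (abs_add_le_of_mem_box hφ hψ z)
      have h2 := abs_le.1 (abs_add_le_of_mem_box hφ' hψ' z)
      exact abs_le.2 ⟨by linarith, by linarith⟩
    have hfac : planDensity c ε ((1 - t) • φ + t • φ') ((1 - t) • ψ + t • ψ') z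
        = planDensity c ε φ ψ z * Real.exp (t * Δ / ε) := by
      rw [planDensity, planDensity, ← Real.exp_add]
      congr 1
      simp only [Pi.add_apply, Pi.smul_apply, smul_eq_mul, hΔ]
      ring
    have hsmall : |t * Δ / ε| ≤ 1 := by
      rw [abs_div, abs_mul, abs_of_pos ht0, abs_of_pos hε, div_le_one hε]
      exact (mul_le_mul_of_nonneg_left hΔD ht0.le).trans htD
    have hexp := (abs_le.1 (Real.abs_exp_sub_one_sub_id_le hsmall)).2
    have hp := planDensity_pos c ε φ ψ z
    have hpn := planDensity_le (c := c) hε hφ hψ z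
    have hquad : ε * (planDensity c ε φ ψ z * (t * Δ / ε) ^ 2) ≤ t ^ 2 * A := by
      have h1 : planDensity c ε φ ψ z * Δ ^ 2 ≤ Real.exp (2 * n / ε) * D ^ 2 := by
        refine mul_le_mul hpn ?_ (sq_nonneg _) (Real.exp_pos _).le
        rw [← sq_abs Δ]
        exact pow_le_pow_left₀ (abs_nonneg _) hΔD 2
      have h2 : ε * (planDensity c ε φ ψ z * (t * Δ / ε) ^ 2)
          = t ^ 2 * (planDensity c ε φ ψ z * Δ ^ 2 / ε) := by
        field_simp
      rw [h2, hA]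
      gcongr
    have hlin : ε * (planDensity c ε φ ψ z * (t * Δ / ε)) = t * (Δ * planDensity c ε φ ψ z) := by
      field_simp
    rw [hfac]
    have := mul_le_mul_of_nonneg_left hexp (mul_pos hε hp).le
    nlinarith
  have h₂ : Integrable (fun z => ε * planDensity c ε φ ψ z
      + t * ((φ' z.1 + ψ' z.2 - (φ z.1 + ψ z.2)) * planDensity c ε φ ψ z)) m :=
    (hr.const_mul ε).add (hΔr.const_mul t)
  have hint := integral_mono ((integrable_planDensity m hc hε hφt hψt).const_mul ε)
    (h₂.add (integrable_const (t ^ 2 * A))) hexp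
  rw [integral_add' h₂ (integrable_const _),
    integral_add (hr.const_mul ε) (hΔr.const_mul t), integral_const_mul, integral_const_mul,
    integral_const_mul, integral_const, probReal_univ, one_smul] at hint
  have e1 : ∫ x, ((1 - t) • φ + t • φ') x ∂μ = (1 - t) * ∫ x, φ x ∂μ + t * ∫ x, φ' x ∂μ := by
    simp only [Pi.add_apply, Pi.smul_apply, smul_eq_mul]
    rw [integral_add ((Penalty.integrable_of_mem_box hφ μ).const_mul _)
      ((Penalty.integrable_of_mem_box hφ' μ).const_mul _), integral_const_mul, integral_const_mul]
  have e2 : ∫ x, ((1 - t) • ψ + t • ψ') x ∂ν = (1 - t) * ∫ x, ψ x ∂ν + t * ∫ x, ψ' x ∂ν := by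
    simp only [Pi.add_apply, Pi.smul_apply, smul_eq_mul]
    rw [integral_add ((Penalty.integrable_of_mem_box hψ ν).const_mul _)
      ((Penalty.integrable_of_mem_box hψ' ν).const_mul _), integral_const_mul, integral_const_mul]
  simp only [dualValue, e1, e2] at hle
  rw [dualSlope]
  have h1 : t ^ 2 * A ≤ t * (δ / 2) := by
    rw [pow_two, mul_assoc]
    exact mul_le_mul_of_nonneg_left htA ht0.le
  refine le_of_mul_le_mul_left ?_ ht0
  linarith

/-! ### The limiting plan -/

/-- A plan density whose Lagrangian is bounded, for all bounded potentials, by any upper bound of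
the dual functional. It is the almost everywhere limit of plans induced by almost stationary
potentials on growing boxes: along such a sequence the dual values converge, so by strong concavity
the square roots of the plans form a Cauchy sequence in `L²`. -/
theorem exists_density_lagrangian_le (hc : Measurable c) (hε : 0 < ε) {D : ℝ}
    (hD : ∀ n : ℝ, ∀ φ ∈ k₁.box l₁ n, ∀ ψ ∈ k₂.box l₂ n, dualValue c ε μ ν m φ ψ ≤ D) :
    ∃ r : X × X → ℝ, Measurable r ∧ (∀ z, 0 ≤ r z) ∧
      ∀ N : ℝ, 0 ≤ N → ∀ φ' ∈ k₁.box l₁ N, ∀ ψ' ∈ k₂.box l₂ N,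
        Integrable (fun z => transportEntropy (c z) ε (r z) - (φ' z.1 + ψ' z.2) * r z) m ∧
        ∫ z, (transportEntropy (c z) ε (r z) - (φ' z.1 + ψ' z.2) * r z) ∂m
          + ∫ x, φ' x ∂μ + ∫ y, ψ' y ∂ν ≤ D := by
  have hex : ∀ n : ℕ, ∃ φ ∈ k₁.box l₁ n, ∃ ψ ∈ k₂.box l₂ n,
      ∀ φ' ∈ k₁.box l₁ n, ∀ ψ' ∈ k₂.box l₂ n,
        dualSlope c ε μ ν m φ ψ φ' ψ' ≤ 1 / ((n : ℝ) + 1) := fun n =>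
    exists_dualSlope_le m μ ν hc hε n.cast_nonneg Nat.one_div_pos_of_nat
  choose φ hφ ψ hψ hslope using hex
  set J : ℕ → ℝ := fun n => dualValue c ε μ ν m (φ n) (ψ n) with hJ
  set s : ℕ → X × X → ℝ := fun n => planDensity c ε (φ n) (ψ n) with hs
  have hδ : Tendsto (fun n : ℕ => 1 / ((n : ℝ) + 1)) atTop (𝓝 0) :=
    tendsto_one_div_add_atTop_nhds_zero_nat
  have hstep : ∀ i j, i ≤ j →
      J i + ε * ∫ z, (√(s j z) - √(s i z)) ^ 2 ∂m ≤ J j + 1 / ((j : ℝ) + 1) := by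
    intro i j hij
    have hij' : (i : ℝ) ≤ j := by exact_mod_cast hij
    exact (dualValue_add_sq_le m μ ν hc hε (hφ j) (hψ j) (hφ i) (hψ i)).trans
      (add_le_add_right (hslope j _ (k₁.box_mono l₁ hij' (hφ i)) _
        (k₂.box_mono l₂ hij' (hψ i))) _)
  have hJbdd : BddAbove (range J) := ⟨D, by
    rintro _ ⟨i, rfl⟩
    exact hD i _ (hφ i) _ (hψ i)⟩
  have hmem : ∀ i, MemLp (fun z => √(s i z)) 2 m := fun i =>
    MemLp.of_bound (measurable_planDensity hc (hφ i).1 (hψ i).1).sqrt.aestronglyMeasurable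
      √(Real.exp (2 * i / ε)) (ae_of_all _ fun z => by
        rw [Real.norm_of_nonneg (Real.sqrt_nonneg _)]
        exact Real.sqrt_le_sqrt (planDensity_le hε (hφ i) (hψ i) z))
  have hcauchy : ∀ τ > 0, ∃ N, ∀ i ≥ N, ∀ j ≥ i, ∫ z, (√(s j z) - √(s i z)) ^ 2 ∂m ≤ τ := by
    intro τ hτ
    -- once some `J a` is within `ε * τ / 3` of `sup J`, so is every later `J i`, up to `1 / (i + 1)`
    have hτ' : 0 < ε * τ / 3 := by positivity
    obtain ⟨_, ⟨a, rfl⟩, ha⟩ := exists_lt_of_lt_csSup (range_nonempty J)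
      (show sSup (range J) - ε * τ / 3 < sSup (range J) by linarith)
    obtain ⟨b, hb⟩ := (hδ.eventually_lt_const hτ').exists_forall_of_atTop
    refine ⟨max a b, fun i hi j hij => ?_⟩
    have h0 : 0 ≤ ε * ∫ z, (√(s i z) - √(s a z)) ^ 2 ∂m :=
      mul_nonneg hε.le (integral_nonneg fun z => sq_nonneg _)
    have h1 := hstep a i ((le_max_left a b).trans hi)
    have h2 := hstep i j hij
    have h3 := le_csSup hJbdd (mem_range_self j)
    have h4 := hb i ((le_max_right a b).trans hi)
    have h5 := hb j (((le_max_right a b).trans hi).trans hij)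
    refine le_of_mul_le_mul_left ?_ hε
    linarith
  obtain ⟨F, ns, hF, hns, hae⟩ := exists_subseq_tendsto_ae_of_cauchy hmem hcauchy
  refine ⟨fun z => F z ^ 2, hF.pow_const 2, fun z => sq_nonneg _, fun N hN φ' hφ' ψ' hψ' => ?_⟩
  have hlim : ∀ᵐ z ∂m, Tendsto (fun i => s (ns i) z) atTop (𝓝 (F z ^ 2)) := by
    filter_upwards [hae] with z hz
    refine (hz.pow 2).congr fun i => ?_
    exact Real.sq_sqrt (planDensity_pos ..).le
  set M : ℝ := ε * Real.exp (2 * N / ε) with hM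
  -- only the terms with `i ≥ ⌈N⌉` are used, for which `(φ', ψ')` lies in the box
  obtain ⟨n₀, hn₀⟩ := exists_nat_ge N
  have hbox : ∀ i, N ≤ ((ns (i + n₀) : ℕ) : ℝ) := fun i => by
    refine hn₀.trans ?_
    exact_mod_cast (Nat.le_add_left _ _).trans (hns.id_le (i + n₀))
  have hL := fun i => integral_transportEntropy_planDensity m μ ν hc hε
    (hφ (ns (i + n₀))) (hψ (ns (i + n₀))) hφ' hψ'
  obtain ⟨hgi, hgle⟩ := integrable_and_integral_le_of_tendsto (m := m)
    (g := fun i z => transportEntropy (c z) ε (s (ns (i + n₀)) z)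
      - (φ' z.1 + ψ' z.2) * s (ns (i + n₀)) z + M)
    (g' := fun z => transportEntropy (c z) ε (F z ^ 2) - (φ' z.1 + ψ' z.2) * F z ^ 2 + M)
    (δ := fun i => 1 / (((ns (i + n₀) : ℕ) : ℝ) + 1))
    (K := D - ∫ x, φ' x ∂μ - ∫ y, ψ' y ∂ν + M)
    (fun i z => by
      have h1 := neg_exp_le_transportEntropy hε (c z) (φ' z.1 + ψ' z.2)
        (planDensity_pos c ε (φ (ns (i + n₀))) (ψ (ns (i + n₀))) z).le
      have h2 := mul_le_mul_of_nonneg_left (planDensity_le (c := c) hε hφ' hψ' z) hε.le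
      rw [planDensity] at h2
      linarith)
    (fun i => (hL i).1.add (integrable_const M))
    (by
      filter_upwards [hlim] with z hz
      have hz' := hz.comp (tendsto_add_atTop_nat n₀)
      exact ((((continuous_transportEntropy (c z) ε).tendsto _).comp hz').sub
        (hz'.const_mul _)).add_const M)
    (hδ.comp (hns.tendsto_atTop.comp (tendsto_add_atTop_nat n₀)))
    (fun i => by
      rw [integral_add (hL i).1 (integrable_const M), integral_const, probReal_univ, one_smul]
      have h1 := (hL i).2
      have h2 := hslope (ns (i + n₀)) _ (k₁.box_mono l₁ (hbox i) hφ') _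
        (k₂.box_mono l₂ (hbox i) hψ')
      have h3 := hD _ _ (hφ (ns (i + n₀))) _ (hψ (ns (i + n₀)))
      linarith)
  have hgi' : Integrable
      (fun z => transportEntropy (c z) ε (F z ^ 2) - (φ' z.1 + ψ' z.2) * F z ^ 2) m := by
    refine (hgi.sub (integrable_const M)).congr (ae_of_all _ fun z => ?_)
    simp
  refine ⟨hgi', ?_⟩
  rw [integral_add hgi' (integrable_const M), integral_const, probReal_univ, one_smul] at hgle
  linarith

end Dual

section Duality

variable {X : Type*} [MeasurableSpace X]

/-! ### The primal objective -/

section Primal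

variable {c : X × X → ℝ≥0} {ε : ℝ} {k₁ k₂ : Penalty} {l₁ l₂ : X → ℝ≥0} {μ ν ρ₁ ρ₂ : Measure X}
  {γ : Measure (X × X)}

theorem primalObjective_eq_top (hε : 0 < ε) (hc : Measurable c)
    (h : ¬ (Integrable (fun z => (c z : ℝ)) γ ∧
      Integrable (fun z => (Real.log (γ.rnDeriv (ρ₁.prod ρ₂) z).toReal - 1)
        * (γ.rnDeriv (ρ₁.prod ρ₂) z).toReal) (ρ₁.prod ρ₂))) :
    primalObjective c ε k₁ k₂ l₁ l₂ μ ν ρ₁ ρ₂ γ = ⊤ := by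
  have hsum : ((∫⁻ z, (c z : ℝ≥0∞) ∂γ : ℝ≥0∞) : EReal) + (ε : EReal) * negEntropy (ρ₁.prod ρ₂) γ
      = ⊤ := by
    by_cases hent : Integrable (fun z => (Real.log (γ.rnDeriv (ρ₁.prod ρ₂) z).toReal - 1)
        * (γ.rnDeriv (ρ₁.prod ρ₂) z).toReal) (ρ₁.prod ρ₂)
    · have htop : ∫⁻ z, (c z : ℝ≥0∞) ∂γ = ∞ := by
        by_contra hne
        refine h ⟨?_, hent⟩
        refine (lintegral_ofReal_ne_top_iff_integrable (by fun_prop)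
          (ae_of_all _ fun z => (c z).coe_nonneg)).1 ?_
        simpa using hne
      rw [htop, negEntropy, if_pos hent, EReal.coe_ennreal_top, ← EReal.coe_mul]
      exact EReal.top_add_coe _
    · rw [negEntropy, if_neg hent, EReal.coe_mul_top_of_pos hε]
      exact EReal.add_top_of_ne_bot (EReal.coe_ennreal_ne_bot _)
  rw [primalObjective, hsum, EReal.top_add_of_ne_bot (EReal.coe_ennreal_ne_bot _),
    EReal.top_add_of_ne_bot (EReal.coe_ennreal_ne_bot _)]

theorem map_fst_absolutelyContinuous [IsProbabilityMeasure ρ₂] (hγ : γ ≪ ρ₁.prod ρ₂) :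
    γ.map Prod.fst ≪ ρ₁ := by
  have := hγ.map measurable_fst
  rwa [Measure.map_fst_prod, measure_univ, one_smul] at this

theorem map_snd_absolutelyContinuous [IsProbabilityMeasure ρ₁] [IsProbabilityMeasure ρ₂]
    (hγ : γ ≪ ρ₁.prod ρ₂) : γ.map Prod.snd ≪ ρ₂ := by
  have := hγ.map measurable_snd
  rwa [Measure.map_snd_prod, measure_univ, one_smul] at this

variable [IsProbabilityMeasure ρ₁] [IsProbabilityMeasure ρ₂] [IsFiniteMeasure γ]

theorem integral_map_fst_add_integral_map_snd (hγ : γ ≪ ρ₁.prod ρ₂) {φ ψ : X → ℝ}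
    (hφ : Integrable φ (γ.map Prod.fst)) (hψ : Integrable ψ (γ.map Prod.snd)) :
    Integrable (fun z => (γ.rnDeriv (ρ₁.prod ρ₂) z).toReal • (φ z.1 + ψ z.2)) (ρ₁.prod ρ₂) ∧
    ∫ x, φ x ∂(γ.map Prod.fst) + ∫ y, ψ y ∂(γ.map Prod.snd)
      = ∫ z, (γ.rnDeriv (ρ₁.prod ρ₂) z).toReal • (φ z.1 + ψ z.2) ∂(ρ₁.prod ρ₂) := by
  have hφ₁ : Integrable (fun z : X × X => φ z.1) γ := hφ.comp_measurable measurable_fst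
  have hψ₂ : Integrable (fun z : X × X => ψ z.2) γ := hψ.comp_measurable measurable_snd
  refine ⟨(integrable_rnDeriv_smul_iff hγ).2 (hφ₁.add hψ₂), ?_⟩
  rw [integral_rnDeriv_smul hγ, integral_add hφ₁ hψ₂,
    integral_map measurable_fst.aemeasurable hφ.aestronglyMeasurable,
    integral_map measurable_snd.aemeasurable hψ.aestronglyMeasurable]

/-- The primal objective of a plan with finite transport cost and finite entropy. -/
theorem primalObjective_eq (hγ : γ ≪ ρ₁.prod ρ₂) (hci : Integrable (fun z => (c z : ℝ)) γ)
    (hent : Integrable (fun z => (Real.log (γ.rnDeriv (ρ₁.prod ρ₂) z).toReal - 1)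
      * (γ.rnDeriv (ρ₁.prod ρ₂) z).toReal) (ρ₁.prod ρ₂)) :
    Integrable (fun z => transportEntropy (c z) ε (γ.rnDeriv (ρ₁.prod ρ₂) z).toReal)
      (ρ₁.prod ρ₂) ∧
    primalObjective c ε k₁ k₂ l₁ l₂ μ ν ρ₁ ρ₂ γ
      = ((∫ z, transportEntropy (c z) ε (γ.rnDeriv (ρ₁.prod ρ₂) z).toReal ∂(ρ₁.prod ρ₂) : ℝ) : EReal)
        + (k₁.cost l₁ (γ.map Prod.fst) μ : EReal) + (k₂.cost l₂ (γ.map Prod.snd) ν : EReal) := by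
  have hci' := (integrable_rnDeriv_smul_iff hγ).2 hci
  have heq : (fun z => transportEntropy (c z) ε (γ.rnDeriv (ρ₁.prod ρ₂) z).toReal)
      = fun z => (γ.rnDeriv (ρ₁.prod ρ₂) z).toReal • (c z : ℝ)
        + ε * ((Real.log (γ.rnDeriv (ρ₁.prod ρ₂) z).toReal - 1)
          * (γ.rnDeriv (ρ₁.prod ρ₂) z).toReal) := by
    funext z
    rw [transportEntropy, smul_eq_mul]
    ring
  have hlin : ∫⁻ z, (c z : ℝ≥0∞) ∂γ = ENNReal.ofReal (∫ z, (c z : ℝ) ∂γ) := by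
    rw [ofReal_integral_eq_lintegral_ofReal hci (ae_of_all _ fun z => (c z).coe_nonneg)]
    simp
  rw [heq]
  refine ⟨hci'.add (hent.const_mul ε), ?_⟩
  rw [integral_add hci' (hent.const_mul ε), integral_rnDeriv_smul hγ, integral_const_mul,
    primalObjective, negEntropy, if_pos hent, hlin, EReal.coe_ennreal_ofReal,
    max_eq_left (integral_nonneg fun z => (c z).coe_nonneg), EReal.coe_add, EReal.coe_mul]

end Primal

/-! ### Weak duality -/

section Weak

variable {c : X × X → ℝ≥0} {ε : ℝ} {k₁ k₂ : Penalty} {l₁ l₂ : X → ℝ≥0} {ρ ρ₁ ρ₂ : Measure X}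

theorem exists_ae_abs_le (φ : Lp ℝ ∞ ρ) : ∃ N : ℝ, ∀ᵐ x ∂ρ, |φ x| ≤ N := by
  have h := (Lp.memLp φ).2
  rw [eLpNorm_exponent_top] at h
  refine ⟨(eLpNormEssSup φ ρ).toReal, ?_⟩
  filter_upwards [ae_le_eLpNormEssSup (f := φ) (μ := ρ)] with x hx
  have := ENNReal.toReal_mono h.ne hx
  simpa using this

theorem integrable_Lp_top_of_absolutelyContinuous (φ : Lp ℝ ∞ ρ) {α : Measure X} [IsFiniteMeasure α]
    (hα : α ≪ ρ) : Integrable φ α := by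
  obtain ⟨N, hN⟩ := exists_ae_abs_le φ
  exact Integrable.of_bound ((Lp.aestronglyMeasurable φ).mono_ac hα) N (hα hN)

/-- The additive constant `-ε ⟨K, dxdy⟩` cancels the `-1` in the dual objective. -/
theorem dualObjective_sub_gibbs {μ ν : Measure X} {φ ψ : X → ℝ}
    (hp : Integrable (planDensity c ε φ ψ) (ρ₁.prod ρ₂))
    (hg : Integrable (gibbs c ε) (ρ₁.prod ρ₂)) :
    dualObjective c ε l₁ l₂ μ ν ρ₁ ρ₂ φ ψ - ε * ∫ z, gibbs c ε z ∂(ρ₁.prod ρ₂)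
      = ∫ x, min (φ x) (l₁ x : ℝ) ∂μ + ∫ y, min (ψ y) (l₂ y : ℝ) ∂ν
        - ε * ∫ z, planDensity c ε φ ψ z ∂(ρ₁.prod ρ₂) := by
  have heq : (fun z : X × X => (Real.exp ((φ z.1 + ψ z.2) / ε) - 1) * gibbs c ε z)
      = fun z => planDensity c ε φ ψ z - gibbs c ε z := by
    funext z
    rw [gibbs, planDensity, sub_mul, one_mul, ← Real.exp_add]
    ring_nf
  rw [dualObjective, heq, integral_sub hp hg]
  ring

variable [IsProbabilityMeasure ρ₁] [IsProbabilityMeasure ρ₂]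

theorem integrable_gibbs (hc : Measurable c) (hε : 0 < ε) :
    Integrable (gibbs c ε) (ρ₁.prod ρ₂) := by
  refine Integrable.of_bound (C := 1) ?_ (ae_of_all _ fun z => ?_)
  · have : Measurable (gibbs c ε) := by
      unfold gibbs
      fun_prop
    exact this.aestronglyMeasurable
  · rw [gibbs, Real.norm_of_nonneg (Real.exp_pos _).le, Real.exp_le_one_iff]
    exact div_nonpos_of_nonpos_of_nonneg (neg_nonpos.2 (c z).coe_nonneg) hε.le

theorem integrable_planDensity_Lp (hc : Measurable c) (hε : 0 < ε) (φ : Lp ℝ ∞ ρ₁)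
    (ψ : Lp ℝ ∞ ρ₂) : Integrable (planDensity c ε φ ψ) (ρ₁.prod ρ₂) := by
  obtain ⟨N₁, h₁⟩ := exists_ae_abs_le φ
  obtain ⟨N₂, h₂⟩ := exists_ae_abs_le ψ
  have hm : Measurable (planDensity c ε φ ψ) :=
    measurable_planDensity hc (Lp.stronglyMeasurable φ).measurable
      (Lp.stronglyMeasurable ψ).measurable
  refine Integrable.of_bound hm.aestronglyMeasurable (Real.exp ((N₁ + N₂) / ε)) ?_
  filter_upwards [Measure.quasiMeasurePreserving_fst.ae h₁,
    Measure.quasiMeasurePreserving_snd.ae h₂] with z hz₁ hz₂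
  rw [Real.norm_of_nonneg (planDensity_pos ..).le]
  refine Real.exp_le_exp.2 (div_le_div_of_nonneg_right ?_ hε.le)
  linarith [(abs_le.1 hz₁).2, (abs_le.1 hz₂).2, (c z).coe_nonneg]

variable {μ ν : Measure X} [IsFiniteMeasure μ] [IsFiniteMeasure ν]

/-- Weak duality. -/
theorem dualObjective_sub_le_primalObjective (hc : Measurable c) (hε : 0 < ε)
    (hl₁ : Measurable l₁) (hl₂ : Measurable l₂) {C₁ C₂ : ℝ≥0} (hC₁ : ∀ x, l₁ x ≤ C₁)
    (hC₂ : ∀ x, l₂ x ≤ C₂) (hμ : μ ≪ ρ₁) (hν : ν ≪ ρ₂) {γ : Measure (X × X)} [IsFiniteMeasure γ]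
    (hγ : γ ≪ ρ₁.prod ρ₂) (φ : Lp ℝ ∞ ρ₁) (ψ : Lp ℝ ∞ ρ₂)
    (hφ : (φ : X → ℝ) ∈ k₁.dualConstraint l₁ ρ₁) (hψ : (ψ : X → ℝ) ∈ k₂.dualConstraint l₂ ρ₂) :
    ((dualObjective c ε l₁ l₂ μ ν ρ₁ ρ₂ φ ψ - ε * ∫ z, gibbs c ε z ∂(ρ₁.prod ρ₂) : ℝ) : EReal)
      ≤ primalObjective c ε k₁ k₂ l₁ l₂ μ ν ρ₁ ρ₂ γ := by
  by_cases hfin : Integrable (fun z => (c z : ℝ)) γ ∧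
      Integrable (fun z => (Real.log (γ.rnDeriv (ρ₁.prod ρ₂) z).toReal - 1)
        * (γ.rnDeriv (ρ₁.prod ρ₂) z).toReal) (ρ₁.prod ρ₂)
  swap
  · rw [primalObjective_eq_top hε hc hfin]
    exact le_top
  obtain ⟨hte, heq⟩ := primalObjective_eq (ε := ε) (k₁ := k₁) (k₂ := k₂) (l₁ := l₁) (l₂ := l₂)
    (μ := μ) (ν := ν) hγ hfin.1 hfin.2
  rw [heq]
  have hγ₁ := map_fst_absolutelyContinuous hγ
  have hγ₂ := map_snd_absolutelyContinuous hγ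
  have hφγ := integrable_Lp_top_of_absolutelyContinuous φ hγ₁
  have hψγ := integrable_Lp_top_of_absolutelyContinuous ψ hγ₂
  have hcost₁ := k₁.integral_min_sub_le_cost hl₁ hC₁ hφγ
    (integrable_Lp_top_of_absolutelyContinuous φ hμ)
    (fun hk => by subst hk; exact hγ₁ hφ.1)
  have hcost₂ := k₂.integral_min_sub_le_cost hl₂ hC₂ hψγ
    (integrable_Lp_top_of_absolutelyContinuous ψ hν)
    (fun hk => by subst hk; exact hγ₂ hψ.1)
  have hp := integrable_planDensity_Lp hc hε φ ψ
  rw [dualObjective_sub_gibbs hp (integrable_gibbs hc hε)]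
  obtain ⟨hint, hsum⟩ := integral_map_fst_add_integral_map_snd hγ hφγ hψγ
  have hyoung : -(ε * ∫ z, planDensity c ε φ ψ z ∂(ρ₁.prod ρ₂))
      ≤ ∫ z, transportEntropy (c z) ε (γ.rnDeriv (ρ₁.prod ρ₂) z).toReal ∂(ρ₁.prod ρ₂)
        - ∫ z, (γ.rnDeriv (ρ₁.prod ρ₂) z).toReal • (φ z.1 + ψ z.2) ∂(ρ₁.prod ρ₂) := by
    rw [← integral_sub hte hint, ← integral_const_mul, ← integral_neg]
    refine integral_mono (hp.const_mul ε).neg (hte.sub hint) fun z => ?_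
    have := neg_exp_le_transportEntropy hε (c z) (φ z.1 + ψ z.2)
      (ENNReal.toReal_nonneg (a := γ.rnDeriv (ρ₁.prod ρ₂) z))
    simpa [planDensity, mul_comm] using this
  refine le_trans ?_ (add_le_add (add_le_add le_rfl hcost₁) hcost₂)
  rw [← EReal.coe_add, ← EReal.coe_add, EReal.coe_le_coe_iff]
  linarith

end Weak

/-! ### Strong duality -/

section Strong

variable {c : X × X → ℝ≥0} {ε : ℝ} {k₁ k₂ : Penalty} {l₁ l₂ : X → ℝ≥0} {ρ₁ ρ₂ : Measure X}
  [IsProbabilityMeasure ρ₁] [IsProbabilityMeasure ρ₂]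
  {μ ν : Measure X}

/-- Potentials in a box are admissible for the dual problem, and there the truncation by `l₁`, `l₂`
has no effect. -/
theorem dualValue_add_le_dualEgopt (hc : Measurable c) (hε : 0 < ε) (hl₁ : Measurable l₁)
    (hl₂ : Measurable l₂) (hμ : μ ≪ ρ₁) (hν : ν ≪ ρ₂) {n : ℝ} {φ ψ : X → ℝ}
    (hφ : φ ∈ k₁.box l₁ n) (hψ : ψ ∈ k₂.box l₂ n) :
    ((dualValue c ε μ ν (ρ₁.prod ρ₂) φ ψ + ε * ∫ z, gibbs c ε z ∂(ρ₁.prod ρ₂) : ℝ) : EReal)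
      ≤ dualEgopt c ε k₁ k₂ l₁ l₂ μ ν ρ₁ ρ₂ := by
  have hφL : MemLp φ ∞ ρ₁ :=
    memLp_top_of_bound hφ.1.aestronglyMeasurable n (ae_of_all _ hφ.2.1)
  have hψL : MemLp ψ ∞ ρ₂ :=
    memLp_top_of_bound hψ.1.aestronglyMeasurable n (ae_of_all _ hψ.2.1)
  have eφ := hφL.coeFn_toLp
  have eψ := hψL.coeFn_toLp
  have hval : dualValue c ε μ ν (ρ₁.prod ρ₂) φ ψ + ε * ∫ z, gibbs c ε z ∂(ρ₁.prod ρ₂)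
      = dualObjective c ε l₁ l₂ μ ν ρ₁ ρ₂ (hφL.toLp φ) (hψL.toLp ψ) := by
    rw [← eq_sub_iff_add_eq, dualObjective_sub_gibbs (integrable_planDensity_Lp hc hε _ _)
      (integrable_gibbs hc hε), dualValue]
    congr 1
    · congr 1
      · refine integral_congr_ae ?_
        filter_upwards [hμ eφ] with x hx
        rw [hx, min_eq_left (hφ.2.2.1 x)]
      · refine integral_congr_ae ?_
        filter_upwards [hν eψ] with x hx
        rw [hx, min_eq_left (hψ.2.2.1 x)]
    · congr 1
      refine integral_congr_ae ?_
      filter_upwards [Measure.quasiMeasurePreserving_fst.ae eφ,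
        Measure.quasiMeasurePreserving_snd.ae eψ] with z hz₁ hz₂
      rw [planDensity, planDensity, hz₁, hz₂]
  rw [hval]
  exact le_iSup₂_of_le (hφL.toLp φ) (hψL.toLp ψ) (le_iSup₂_of_le
    (k₁.dualConstraint_congr l₁ eφ.symm (Penalty.mem_dualConstraint_of_mem_box hφ hl₁ ρ₁))
    (k₂.dualConstraint_congr l₂ eψ.symm (Penalty.mem_dualConstraint_of_mem_box hψ hl₂ ρ₂)) le_rfl)

variable [IsFiniteMeasure μ] [IsFiniteMeasure ν]

/-- The cost term and the entropy are bounded below, so integrability of their sum passes to each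
of them, and superlinearity of the entropy makes the density integrable. -/
theorem integrable_of_integrable_transportEntropy {Z : Type*} [MeasurableSpace Z] {m : Measure Z}
    [IsFiniteMeasure m] {c : Z → ℝ≥0} (hc : Measurable c) (hε : 0 < ε) {r : Z → ℝ}
    (hr : Measurable r) (hr0 : ∀ z, 0 ≤ r z)
    (h : Integrable (fun z => transportEntropy (c z) ε (r z)) m) :
    Integrable r m ∧ Integrable (fun z => c z * r z) m ∧
      Integrable (fun z => (Real.log (r z) - 1) * r z) m := by
  have hc' : Integrable (fun z => c z * r z) m := by
    refine Integrable.mono' (h.add (integrable_const ε)) (by fun_prop) (ae_of_all _ fun z => ?_)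
    rw [Real.norm_of_nonneg (mul_nonneg (c z).coe_nonneg (hr0 z))]
    have h1 := neg_exp_le_transportEntropy hε 0 0 (hr0 z)
    simp only [transportEntropy, sub_self, zero_div, Real.exp_zero, zero_mul] at h1
    simp only [Pi.add_apply, transportEntropy]
    linarith
  have hent : Integrable (fun z => (Real.log (r z) - 1) * r z) m := by
    refine ((h.sub hc').const_mul ε⁻¹).congr (ae_of_all _ fun z => ?_)
    simp only [Pi.sub_apply, transportEntropy]
    field_simp
    ring
  refine ⟨?_, hc', hent⟩
  refine Integrable.mono' (hent.add (integrable_const (Real.exp 1))) hr.aestronglyMeasurable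
    (ae_of_all _ fun z => ?_)
  rw [Real.norm_of_nonneg (hr0 z)]
  have h1 := neg_exp_le_transportEntropy one_pos 0 1 (hr0 z)
  simp only [transportEntropy, zero_mul, sub_zero, div_one, one_mul] at h1
  simp only [Pi.add_apply]
  linarith

/-- Strong duality: some plan has primal objective at most any given real upper bound `D` of the dual
functional on the boxes. -/
theorem egopt_le_of_forall_dualValue_le (hc : Measurable c) (hε : 0 < ε)
    (hl₁ : Measurable l₁) (hl₂ : Measurable l₂) {C₁ C₂ : ℝ≥0} (hC₁ : ∀ x, l₁ x ≤ C₁)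
    (hC₂ : ∀ x, l₂ x ≤ C₂) {D : ℝ}
    (hD : ∀ n : ℝ, ∀ φ ∈ k₁.box l₁ n, ∀ ψ ∈ k₂.box l₂ n,
      dualValue c ε μ ν (ρ₁.prod ρ₂) φ ψ ≤ D) :
    egopt c ε k₁ k₂ l₁ l₂ μ ν ρ₁ ρ₂ ≤ (D : EReal) := by
  obtain ⟨r, hr, hr0, hL⟩ := exists_density_lagrangian_le (ρ₁.prod ρ₂) μ ν hc hε hD
  have hte : Integrable (fun z => transportEntropy (c z) ε (r z)) (ρ₁.prod ρ₂) := by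
    simpa using (hL 0 le_rfl _ (k₁.zero_mem_box l₁ le_rfl) _ (k₂.zero_mem_box l₂ le_rfl)).1
  obtain ⟨hri, hcr, hent⟩ := integrable_of_integrable_transportEntropy hc hε hr hr0 hte
  set γ : Measure (X × X) := (ρ₁.prod ρ₂).withDensity fun z => ENNReal.ofReal (r z) with hγdef
  have hγfin : IsFiniteMeasure γ := isFiniteMeasure_withDensity_ofReal hri.2
  have hγ : γ ≪ ρ₁.prod ρ₂ := withDensity_absolutelyContinuous _ _
  have hrn : ∀ᵐ z ∂(ρ₁.prod ρ₂), (γ.rnDeriv (ρ₁.prod ρ₂) z).toReal = r z := by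
    filter_upwards [Measure.rnDeriv_withDensity (ρ₁.prod ρ₂) hr.ennreal_ofReal] with z hz
    rw [hz, ENNReal.toReal_ofReal (hr0 z)]
  have hci : Integrable (fun z => (c z : ℝ)) γ := by
    refine (integrable_rnDeriv_smul_iff hγ).1 (hcr.congr ?_)
    filter_upwards [hrn] with z hz
    rw [hz, smul_eq_mul, mul_comm]
  have hent' : Integrable (fun z => (Real.log (γ.rnDeriv (ρ₁.prod ρ₂) z).toReal - 1)
      * (γ.rnDeriv (ρ₁.prod ρ₂) z).toReal) (ρ₁.prod ρ₂) := by
    refine hent.congr ?_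
    filter_upwards [hrn] with z hz
    rw [hz]
  refine (iInf₂_le γ ⟨hγfin, hγ⟩).trans ?_
  rw [(primalObjective_eq hγ hci hent').2]
  set F : ℝ := ∫ z, transportEntropy (c z) ε (r z) ∂(ρ₁.prod ρ₂) with hF
  have hF' : ∫ z, transportEntropy (c z) ε (γ.rnDeriv (ρ₁.prod ρ₂) z).toReal ∂(ρ₁.prod ρ₂)
      = F := by
    refine integral_congr_ae ?_
    filter_upwards [hrn] with z hz
    rw [hz]
  rw [hF']
  have hlag : ∀ n₁ : ℝ, ∀ φ ∈ k₁.box l₁ n₁, ∀ n₂ : ℝ, ∀ ψ ∈ k₂.box l₂ n₂,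
      (∫ x, φ x ∂μ - ∫ x, φ x ∂(γ.map Prod.fst)) + (∫ y, ψ y ∂ν - ∫ y, ψ y ∂(γ.map Prod.snd))
        ≤ D - F := by
    intro n₁ φ hφ n₂ ψ hψ
    have hφ' := k₁.box_mono l₁ ((le_max_left n₁ n₂).trans (le_max_right 0 _)) hφ
    have hψ' := k₂.box_mono l₂ ((le_max_right n₁ n₂).trans (le_max_right 0 _)) hψ
    have h1 := (hL _ (le_max_left _ _) φ hφ' ψ hψ').2
    rw [integral_sub hte (integrable_add_mul _ hφ' hψ' hri)] at h1
    have hφγ := Penalty.integrable_of_mem_box hφ (γ.map Prod.fst)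
    have hψγ := Penalty.integrable_of_mem_box hψ (γ.map Prod.snd)
    have h2 : ∫ z, (φ z.1 + ψ z.2) * r z ∂(ρ₁.prod ρ₂)
        = ∫ x, φ x ∂(γ.map Prod.fst) + ∫ y, ψ y ∂(γ.map Prod.snd) := by
      rw [(integral_map_fst_add_integral_map_snd hγ hφγ hψγ).2]
      refine integral_congr_ae ?_
      filter_upwards [hrn] with z hz
      rw [hz, smul_eq_mul, mul_comm]
    linarith
  -- the two penalties are suprema over independent potentials; take one supremum after the other
  have hcost₁ : ∀ n₂ : ℝ, ∀ ψ ∈ k₂.box l₂ n₂, k₁.cost l₁ (γ.map Prod.fst) μ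
      ≤ ENNReal.ofReal (D - F - (∫ y, ψ y ∂ν - ∫ y, ψ y ∂(γ.map Prod.snd))) :=
    fun n₂ ψ hψ => k₁.cost_le_of_forall_mem_box hl₁ hC₁ fun n₁ φ hφ => by
      linarith [hlag n₁ φ hφ n₂ ψ hψ]
  have hfin₁ : k₁.cost l₁ (γ.map Prod.fst) μ ≠ ∞ :=
    ((hcost₁ 0 _ (k₂.zero_mem_box l₂ le_rfl)).trans_lt ENNReal.ofReal_lt_top).ne
  set x₁ : ℝ := (k₁.cost l₁ (γ.map Prod.fst) μ).toReal with hx₁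
  have hx : ∀ n₂ : ℝ, ∀ ψ ∈ k₂.box l₂ n₂,
      ∫ y, ψ y ∂ν - ∫ y, ψ y ∂(γ.map Prod.snd) ≤ D - F - x₁ := by
    intro n₂ ψ hψ
    have h0 := hlag 0 _ (k₁.zero_mem_box l₁ le_rfl) n₂ ψ hψ
    simp only [integral_zero, sub_self, zero_add] at h0
    have h1 := ENNReal.toReal_mono ENNReal.ofReal_ne_top (hcost₁ n₂ ψ hψ)
    rw [ENNReal.toReal_ofReal (by linarith)] at h1
    linarith
  have hcost₂ := k₂.cost_le_of_forall_mem_box hl₂ hC₂ hx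
  have hnonneg : 0 ≤ D - F - x₁ := by
    simpa using hx 0 _ (k₂.zero_mem_box l₂ le_rfl)
  have e₁ : (k₁.cost l₁ (γ.map Prod.fst) μ : EReal) = (x₁ : EReal) := by
    rw [hx₁, EReal.coe_ennreal_toReal hfin₁]
  have e₂ : (k₂.cost l₂ (γ.map Prod.snd) ν : EReal) ≤ ((D - F - x₁ : ℝ) : EReal) := by
    have := EReal.coe_ennreal_le_coe_ennreal_iff.2 hcost₂
    rwa [EReal.coe_ennreal_ofReal, max_eq_left hnonneg] at this
  rw [e₁]
  refine (add_le_add le_rfl e₂).trans ?_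
  rw [← EReal.coe_add, ← EReal.coe_add, EReal.coe_le_coe_iff]
  linarith

/-- Duality on an arbitrary measurable space, for a measurable cost. -/
theorem egopt_eq_dualEgopt_sub (hc : Measurable c) (hε : 0 < ε)
    (hl₁ : Measurable l₁) (hl₂ : Measurable l₂) {C₁ C₂ : ℝ≥0} (hC₁ : ∀ x, l₁ x ≤ C₁)
    (hC₂ : ∀ x, l₂ x ≤ C₂) (hμ : μ ≪ ρ₁) (hν : ν ≪ ρ₂) :
    egopt c ε k₁ k₂ l₁ l₂ μ ν ρ₁ ρ₂ = dualEgopt c ε k₁ k₂ l₁ l₂ μ ν ρ₁ ρ₂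
      - ((ε * ∫ z, gibbs c ε z ∂(ρ₁.prod ρ₂) : ℝ) : EReal) := by
  set κ : ℝ := ε * ∫ z, gibbs c ε z ∂(ρ₁.prod ρ₂) with hκ
  apply le_antisymm
  · refine EReal.le_of_forall_lt_iff_le.1 fun D hD => ?_
    refine egopt_le_of_forall_dualValue_le hc hε hl₁ hl₂ hC₁ hC₂ fun n φ hφ ψ hψ => ?_
    have h1 := dualValue_add_le_dualEgopt hc hε hl₁ hl₂ hμ hν hφ hψ
    have h2 : ((dualValue c ε μ ν (ρ₁.prod ρ₂) φ ψ : ℝ) : EReal)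
        ≤ dualEgopt c ε k₁ k₂ l₁ l₂ μ ν ρ₁ ρ₂ - (κ : EReal) := by
      rw [EReal.le_sub_iff_add_le (Or.inl (EReal.coe_ne_bot _)) (Or.inl (EReal.coe_ne_top _)),
        ← EReal.coe_add]
      exact h1
    exact EReal.coe_le_coe_iff.1 (h2.trans hD.le)
  · rw [EReal.sub_le_iff_le_add (Or.inl (EReal.coe_ne_bot _)) (Or.inl (EReal.coe_ne_top _))]
    refine iSup₂_le fun φ ψ => iSup₂_le fun hφ hψ => ?_
    rw [← EReal.sub_le_iff_le_add (Or.inl (EReal.coe_ne_bot _)) (Or.inl (EReal.coe_ne_top _)),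
      ← EReal.coe_sub]
    refine le_iInf₂ fun γ hγ => ?_
    have := hγ.1
    exact dualObjective_sub_le_primalObjective hc hε hl₁ hl₂ hC₁ hC₂ hμ hν hγ.2 φ ψ hφ hψ

end Strong

end Duality

end EGOPT

theorem mainTheorem1 (d : ℕ) (Ω : Set (EuclideanSpace ℝ (Fin d)))
    (hΩ_open : IsOpen Ω) (hΩ_convex : Convex ℝ Ω) (hΩ_nonempty : Ω.Nonempty)
    (c : Ω × Ω → ℝ≥0) (hc : LowerSemicontinuous c)
    (l₁ l₂ : Ω → ℝ≥0) (hl₁ : Measurable l₁) (hl₂ : Measurable l₂)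
    (hl₁_bdd : ∃ C : ℝ≥0, ∀ x, l₁ x ≤ C) (hl₂_bdd : ∃ C : ℝ≥0, ∀ y, l₂ y ≤ C)
    (ρ₁ ρ₂ : Measure Ω) [IsProbabilityMeasure ρ₁] [IsProbabilityMeasure ρ₂]
    (μ ν : Measure Ω) [IsFiniteMeasure μ] [IsFiniteMeasure ν]
    (hμ : μ ≪ ρ₁) (hν : ν ≪ ρ₂)
    (ε : ℝ) (hε : 0 < ε) (k₁ k₂ : EGOPT.Penalty) :
    EGOPT.egopt c ε k₁ k₂ l₁ l₂ μ ν ρ₁ ρ₂ =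
      EGOPT.dualEgopt c ε k₁ k₂ l₁ l₂ μ ν ρ₁ ρ₂
        - ((ε * ∫ z, EGOPT.gibbs c ε z ∂(ρ₁.prod ρ₂) : ℝ) : EReal) := by
  obtain ⟨C₁, hC₁⟩ := hl₁_bdd
  obtain ⟨C₂, hC₂⟩ := hl₂_bdd
  exact EGOPT.egopt_eq_dualEgopt_sub hc.measurable hε hl₁ hl₂ hC₁ hC₂ hμ hν
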